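/- Let $d$ and $\sigma$ be real numbers with $\sigma>\tfrac12$ and critical index $s_c:=\tfrac d2-\tfrac1\sigma=\tfrac12$ (that is, $d=1+\tfrac2\sigma$), and let $a>0$. Then there is a function $Q:[0,\infty)\to\mathbb C$ of class $C^2$, not identically zero, which satisfies the profile equation $$Q_{\xi\xi}+\frac{d-1}{\xi}\,Q_\xi-Q+ia\Big(\frac{Q}{\sigma}+\xi Q_\xi\Big)+|Q|^{2\sigma}Q=0\qquad\text{for all }\xi>0,$$ together with the conditions $Q_\xi(0)=0$, $Q(0)\in\mathbb R$ and $\lim_{\xi\to\infty}Q(\xi)=0$, and which has the form $$Q(\xi)=\frac{1}{\xi^{1/\sigma}}\,R(\xi)\qquad\text{for all }\xi>0$$ with a bounded function $R:(0,\infty)\to\mathbb C$. In particular there is a constant $C$ with $|Q(\xi)|\le C\,\xi^{-1/\sigma}$ for all $\xi>0$. -/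

import Mathlib

open Set Filter Topology

/-- The scaling-critical Sobolev index `s_c = d / 2 - 1 / σ` of the nonlinear Schrödinger equation
with nonlinearity `|u|^(2σ) u` in dimension `d` (a real parameter in the radial setting). -/
noncomputable def criticalIndex (d σ : ℝ) : ℝ := d / 2 - 1 / σ

/-- The radial Laplacian `Δ_ξ = ∂_ξξ + ((d - 1) / ξ) ∂_ξ`, used at `ξ > 0`. -/
noncomputable def radialLaplacian (d : ℝ) (Q : ℝ → ℂ) (ξ : ℝ) : ℂ :=
  deriv (deriv Q) ξ + (((d - 1) / ξ : ℝ) : ℂ) * deriv Q ξ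

/-- `Q` is a global classical (`C²` on `[0, ∞)`) solution of the profile equation
`Δ_ξ Q - Q + i a (Q / σ + ξ Q_ξ) + |Q|^(2σ) Q = 0` together with the conditions
`Q_ξ(0) = 0`, `Q(0)` real and `Q(∞) = 0`. Only the values of `Q` on `[0, ∞)` matter. -/
structure IsGlobalProfile (d σ a : ℝ) (Q : ℝ → ℂ) : Prop where
  contDiffOn : ContDiffOn ℝ 2 Q (Ici 0)
  equation : ∀ ξ : ℝ, 0 < ξ →
    radialLaplacian d Q ξ - Q ξ
      + Complex.I * (a : ℂ) * (Q ξ / (σ : ℂ) + (ξ : ℂ) * deriv Q ξ)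
      + ((‖Q ξ‖ ^ (2 * σ) : ℝ) : ℂ) * Q ξ = 0
  deriv_zero : HasDerivWithinAt Q 0 (Ici 0) 0
  real_zero : (Q 0).im = 0
  tendsto_zero : Tendsto Q atTop (𝓝 0)

/-! The solution with `Q 0 = 1` works for every `a > 0`; what has to be shown is that it is global
and decays.

Global existence. Integrating against `s ^ (d - 1)` turns the profile equation into a Volterra
equation for `(Q, Q_ξ)` that is regular at the origin. With the power frozen above a level `m` it is
globally Lipschitz, hence uniquely solvable on every `[0, T]`. An energy estimate
(`norm_le_of_profileODE`) bounds `Q` independently of `m`, so for `m` large the freezing is never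
felt, and the solutions on `[0, n]` glue together (`exists_global_profileODE`).

Decay. Since `d - 1 = 2 / σ`, the function `R = ξ ^ (1 / σ) Q` solves `R'' = (1 - (c + |R| ^ (2σ)) /
ξ ^ 2) R - i a ξ R'`, whose only first-order term is skew. A decreasing energy then gives `|R'|² ≤
|R|² + 2K` (`exists_normSq_deriv_le`). The momentum `J = Im (conj R * R')` satisfies `J' = -(a ξ /
2) (|R|²)'`, so `J / ξ + (a / 2) |R|²` has derivative `-J / ξ ^ 2`. As `|J| ≤ |R|² + K`, this is a
Grönwall inequality with the integrable rate `1 / ξ ^ 2`, and `R` stays bounded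
(`exists_normSq_le_of_rescaled`). -/

/-! ### Singular Volterra equations: existence and uniqueness. -/

section Volterra

variable {E : Type*} [NormedAddCommGroup E] [NormedSpace ℝ E]

/-- The Picard operator of a singular Volterra equation, with the integral rescaled to `[0, 1]`. -/
noncomputable def volterraMap (K : ℝ → ℝ → E → E) (x₀ : E) (x : ℝ → E) (ξ : ℝ) : E :=
  x₀ + ξ • ∫ t in (0 : ℝ)..1, K t (ξ * t) (x (ξ * t))

theorem continuous_volterraMap {K : ℝ → ℝ → E → E}
    (hK : Continuous fun p : ℝ × ℝ × E => K p.1 p.2.1 p.2.2) (x₀ : E) {x : ℝ → E}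
    (hx : Continuous x) : Continuous (volterraMap K x₀ x) := by
  unfold volterraMap
  refine continuous_const.add (continuous_id.smul ?_)
  refine intervalIntegral.continuous_parametric_intervalIntegral_of_continuous' ?_ 0 1
  exact hK.comp (f := fun p : ℝ × ℝ => (p.2, p.1 * p.2, x (p.1 * p.2))) (by fun_prop)

/-- One Picard step gains a factor `L * s / (n + 1)`, since the integral of `t ^ n` over `[0, 1]` is
`1 / (n + 1)`. Iterating produces the factorial behind both uniqueness and existence. -/
theorem norm_volterraMap_sub_le {K : ℝ → ℝ → E → E}
    (hK : Continuous fun p : ℝ × ℝ × E => K p.1 p.2.1 p.2.2) {L T B : ℝ} (hL : 0 ≤ L)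
    (hLip : ∀ t ∈ Icc (0 : ℝ) 1, ∀ s ∈ Icc 0 T, ∀ x y, ‖K t s x - K t s y‖ ≤ L * ‖x - y‖)
    (x₀ : E) {x y : ℝ → E} (hx : Continuous x) (hy : Continuous y) (n : ℕ)
    (h : ∀ s ∈ Icc 0 T, ‖x s - y s‖ ≤ (L * s) ^ n / n.factorial * B) :
    ∀ s ∈ Icc 0 T, ‖volterraMap K x₀ x s - volterraMap K x₀ y s‖
      ≤ (L * s) ^ (n + 1) / (n + 1).factorial * B := by
  intro s hs
  have hcont : ∀ z : ℝ → E, Continuous z → Continuous fun t : ℝ => K t (s * t) (z (s * t)) :=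
    fun z hz => hK.comp (f := fun t : ℝ => (t, s * t, z (s * t))) (by fun_prop)
  have e : volterraMap K x₀ x s - volterraMap K x₀ y s =
      s • ∫ t in (0 : ℝ)..1, (K t (s * t) (x (s * t)) - K t (s * t) (y (s * t))) := by
    rw [intervalIntegral.integral_sub ((hcont x hx).intervalIntegrable _ _)
      ((hcont y hy).intervalIntegrable _ _)]
    simp only [volterraMap, smul_sub]
    abel
  have hint : ‖∫ t in (0 : ℝ)..1, (K t (s * t) (x (s * t)) - K t (s * t) (y (s * t)))‖ ≤
      ∫ t in (0 : ℝ)..1, L * ((L * s) ^ n / n.factorial * B) * t ^ n := by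
    refine intervalIntegral.norm_integral_le_of_norm_le zero_le_one ?_
      (Continuous.intervalIntegrable (by fun_prop) _ _)
    filter_upwards with t ht
    have ht' : s * t ∈ Icc 0 T :=
      ⟨mul_nonneg hs.1 ht.1.le, (mul_le_of_le_one_right hs.1 ht.2).trans hs.2⟩
    refine (hLip t ⟨ht.1.le, ht.2⟩ _ ht' _ _).trans ?_
    refine (mul_le_mul_of_nonneg_left (h _ ht') hL).trans_eq ?_
    rw [← mul_assoc L s t, mul_pow (L * s) t]
    ring
  rw [e, norm_smul, Real.norm_of_nonneg hs.1]
  refine (mul_le_mul_of_nonneg_left hint hs.1).trans_eq ?_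
  rw [intervalIntegral.integral_const_mul, integral_pow, Nat.factorial_succ]
  have : (n.factorial : ℝ) ≠ 0 := by positivity
  push_cast
  field_simp
  simp only [one_pow, ne_eq, Nat.add_eq_zero_iff, one_ne_zero, and_false, not_false_eq_true,
    zero_pow, sub_zero]
  ring

theorem eqOn_of_volterraMap_eq {K : ℝ → ℝ → E → E}
    (hK : Continuous fun p : ℝ × ℝ × E => K p.1 p.2.1 p.2.2) {L T : ℝ} (hL : 0 ≤ L)
    (hLip : ∀ t ∈ Icc (0 : ℝ) 1, ∀ s ∈ Icc 0 T, ∀ x y, ‖K t s x - K t s y‖ ≤ L * ‖x - y‖)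
    (x₀ : E) {x y : ℝ → E} (hx : Continuous x) (hy : Continuous y)
    (hx' : ∀ s ∈ Icc 0 T, volterraMap K x₀ x s = x s)
    (hy' : ∀ s ∈ Icc 0 T, volterraMap K x₀ y s = y s) : EqOn x y (Icc 0 T) := by
  obtain ⟨B, hB⟩ := (isCompact_Icc (a := (0 : ℝ)) (b := T)).exists_bound_of_continuousOn
    (hx.sub hy).continuousOn
  have key : ∀ n : ℕ, ∀ s ∈ Icc 0 T, ‖x s - y s‖ ≤ (L * s) ^ n / n.factorial * B := by
    intro n
    induction n with
    | zero => intro s hs; simpa using hB s hs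
    | succ n ih =>
      intro s hs
      have := norm_volterraMap_sub_le hK hL hLip x₀ hx hy n ih s hs
      rwa [hx' s hs, hy' s hs] at this
  intro s hs
  have h0 : Tendsto (fun n : ℕ => (L * s) ^ n / n.factorial * B) atTop (𝓝 (0 * B)) :=
    (FloorSemiring.tendsto_pow_div_factorial_atTop (L * s)).mul_const B
  rw [zero_mul] at h0
  have := ge_of_tendsto' h0 fun n => key n s hs
  exact sub_eq_zero.1 (norm_le_zero_iff.1 this)

theorem exists_volterraMap_eq [CompleteSpace E] {K : ℝ → ℝ → E → E}
    (hK : Continuous fun p : ℝ × ℝ × E => K p.1 p.2.1 p.2.2) {L T : ℝ} (hL : 0 ≤ L) (hT : 0 ≤ T)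
    (hLip : ∀ t ∈ Icc (0 : ℝ) 1, ∀ s ∈ Icc 0 T, ∀ x y, ‖K t s x - K t s y‖ ≤ L * ‖x - y‖)
    (x₀ : E) : ∃ x : ℝ → E, Continuous x ∧ ∀ s ∈ Icc 0 T, volterraMap K x₀ x s = x s := by
  let ext : C(Icc 0 T, E) → ℝ → E := fun f => IccExtend hT f
  have hext : ∀ f, Continuous (ext f) := fun f => f.continuous.Icc_extend'
  let Ψ : C(Icc 0 T, E) → C(Icc 0 T, E) := fun f =>
    ⟨fun s => volterraMap K x₀ (ext f) s,
      (continuous_volterraMap hK x₀ (hext f)).comp continuous_subtype_val⟩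
  have hΨ : ∀ f, ∀ s ∈ Icc 0 T, ext (Ψ f) s = volterraMap K x₀ (ext f) s := fun f s hs =>
    IccExtend_of_mem hT _ hs
  have iter : ∀ (n : ℕ) (f g : C(Icc 0 T, E)), ∀ s ∈ Icc 0 T,
      ‖ext (Ψ^[n] f) s - ext (Ψ^[n] g) s‖ ≤ (L * s) ^ n / n.factorial * dist f g := by
    intro n f g
    induction n with
    | zero =>
      intro s hs
      simpa [ext, dist_eq_norm, IccExtend] using
        ContinuousMap.dist_apply_le_dist (f := f) (g := g) (projIcc 0 T hT s)
    | succ n ih =>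
      intro s hs
      simp only [Function.iterate_succ', Function.comp_apply]
      rw [hΨ _ s hs, hΨ _ s hs]
      exact norm_volterraMap_sub_le hK hL hLip x₀ (hext _) (hext _) n ih s hs
  -- No smallness of `T` is needed: some iterate of `Ψ` is a contraction, and its unique fixed point
  -- is also fixed by `Ψ`.
  obtain ⟨n, hn⟩ := ((FloorSemiring.tendsto_pow_div_factorial_atTop (L * T)).eventually
    (gt_mem_nhds (zero_lt_one' ℝ))).exists
  have hn0 : 0 ≤ (L * T) ^ n / n.factorial := by positivity
  have hcontr : ContractingWith ⟨(L * T) ^ n / n.factorial, hn0⟩ Ψ^[n] := by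
    refine ⟨hn, LipschitzWith.of_dist_le_mul fun f g => ?_⟩
    refine (ContinuousMap.dist_le (by positivity)).2 fun s => ?_
    have := iter n f g s s.2
    simp only [ext, IccExtend_of_mem hT _ s.2] at this
    rw [dist_eq_norm]
    refine this.trans ?_
    refine mul_le_mul_of_nonneg_right ?_ dist_nonneg
    change _ ≤ (L * T) ^ n / n.factorial
    have h1 := s.2.1
    have h2 := s.2.2
    gcongr
  have : Nonempty C(Icc 0 T, E) := ⟨0⟩
  refine ⟨ext (ContractingWith.fixedPoint _ hcontr), hext _, fun s hs => ?_⟩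
  rw [← hΨ _ s hs, (ContractingWith.isFixedPt_fixedPoint_iterate hcontr).eq]

end Volterra

/-! ### The truncated nonlinearity and the Lipschitz kernel. -/

theorem rpow_sub_rpow_le {p m r s : ℝ} (hp : 1 ≤ p) (hs : 0 ≤ s) (hsr : s ≤ r) (hr : r ≤ m) :
    r ^ p - s ^ p ≤ p * m ^ (p - 1) * (r - s) := by
  have h := Convex.norm_image_sub_le_of_norm_hasDerivWithin_le (f := fun x : ℝ => x ^ p)
    (f' := fun x : ℝ => p * x ^ (p - 1)) (s := Icc 0 m) (C := p * m ^ (p - 1)) (x := s) (y := r)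
    (fun x _ => (Real.hasDerivAt_rpow_const (Or.inr hp)).hasDerivWithinAt)
    (fun x hx => by
      rw [Real.norm_of_nonneg (by have := Real.rpow_nonneg hx.1 (p - 1); positivity)]
      exact mul_le_mul_of_nonneg_left (Real.rpow_le_rpow hx.1 hx.2 (by linarith)) (by linarith))
    (convex_Icc 0 m) ⟨hs, hsr.trans hr⟩ ⟨hs.trans hsr, hr⟩
  rw [Real.norm_eq_abs, Real.norm_eq_abs, abs_of_nonneg (sub_nonneg.2 hsr)] at h
  exact (le_abs_self _).trans h

/-- The power `|z| ^ p`, frozen beyond `|z| = m`. -/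
noncomputable def truncPow (p m : ℝ) (z : ℂ) : ℝ := min ‖z‖ m ^ p

theorem continuous_truncPow {p m : ℝ} (hp : 0 ≤ p) : Continuous (truncPow p m) :=
  (Real.continuous_rpow_const hp).comp (continuous_norm.min continuous_const)

theorem truncPow_of_le {p m : ℝ} {z : ℂ} (h : ‖z‖ ≤ m) : truncPow p m z = ‖z‖ ^ p := by
  rw [truncPow, min_eq_left h]

theorem norm_truncPow_mul_sub_le {p m : ℝ} (hp : 1 ≤ p) (hm : 0 ≤ m) (z w : ℂ) :
    ‖(truncPow p m z : ℂ) * z - (truncPow p m w : ℂ) * w‖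
      ≤ (m ^ p + p * m ^ (p - 1) * m) * ‖z - w‖ := by
  wlog hzw : ‖w‖ ≤ ‖z‖ generalizing z w
  · have := this w z (le_of_not_ge hzw)
    rwa [norm_sub_rev, norm_sub_rev w z] at this
  have h0 : ∀ u : ℂ, 0 ≤ min ‖u‖ m := fun u => le_min (norm_nonneg _) hm
  have hmon : min ‖w‖ m ≤ min ‖z‖ m := min_le_min_right _ hzw
  have hd := rpow_sub_rpow_le hp (h0 w) hmon (min_le_right _ _)
  have hd0 : 0 ≤ truncPow p m z - truncPow p m w :=
    sub_nonneg.2 (Real.rpow_le_rpow (h0 w) hmon (by linarith))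
  have hz : 0 ≤ truncPow p m z := Real.rpow_nonneg (h0 z) _
  have hz' : truncPow p m z ≤ m ^ p := Real.rpow_le_rpow (h0 z) (min_le_right _ _) (by linarith)
  have hpm : 0 ≤ p * m ^ (p - 1) := by positivity
  -- The difference of powers is paired with the smaller number `w`: either `‖w‖ ≤ m`, or both
  -- powers are frozen and the difference vanishes.
  have key : (truncPow p m z - truncPow p m w) * ‖w‖ ≤ p * m ^ (p - 1) * m * ‖z - w‖ := by
    rcases le_total ‖w‖ m with hw | hw
    · have h1 : min ‖z‖ m - min ‖w‖ m ≤ ‖z - w‖ := by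
        rw [min_eq_left hw]
        exact (sub_le_sub_right (min_le_left _ _) _).trans (norm_sub_norm_le _ _)
      calc (truncPow p m z - truncPow p m w) * ‖w‖
          ≤ (p * m ^ (p - 1) * ‖z - w‖) * m :=
            mul_le_mul (hd.trans (mul_le_mul_of_nonneg_left h1 hpm)) hw (norm_nonneg _)
              (by positivity)
        _ = _ := by ring
    · have : truncPow p m z - truncPow p m w = 0 := by
        rw [truncPow, truncPow, min_eq_right hw, min_eq_right (hw.trans hzw), sub_self]
      rw [this, zero_mul]
      positivity
  have e : (truncPow p m z : ℂ) * z - (truncPow p m w : ℂ) * w =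
      (truncPow p m z : ℂ) * (z - w) + ((truncPow p m z - truncPow p m w : ℝ) : ℂ) * w := by
    push_cast; ring
  rw [e]
  refine (norm_add_le _ _).trans ?_
  rw [norm_mul, norm_mul, Complex.norm_of_nonneg hz, Complex.norm_of_nonneg hd0, add_mul]
  exact add_le_add (mul_le_mul_of_nonneg_right hz' (norm_nonneg _)) key

/-- The profile equation reads `Q_ξξ + ((d - 1) / ξ) Q_ξ = profileForcing σ a h ξ (Q, Q_ξ)`, where
`h Q = |Q| ^ (2σ)`. -/
noncomputable def profileForcing (σ a : ℝ) (h : ℂ → ℝ) (s : ℝ) (x : ℂ × ℂ) : ℂ :=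
  x.1 - Complex.I * (a : ℂ) * (x.1 / (σ : ℂ) + (s : ℂ) * x.2) - (h x.1 : ℂ) * x.1

/-- The Volterra kernel of the profile equation, for the unknown `(Q, Q_ξ)`. -/
noncomputable def profileKernel (d σ a : ℝ) (h : ℂ → ℝ) (t s : ℝ) (x : ℂ × ℂ) : ℂ × ℂ :=
  (x.2, t ^ (d - 1) • profileForcing σ a h s x)

theorem continuous_profileForcing (σ a : ℝ) {h : ℂ → ℝ} (hh : Continuous h) :
    Continuous fun p : ℝ × ℂ × ℂ => profileForcing σ a h p.1 p.2 := by
  unfold profileForcing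
  simp only [div_eq_mul_inv]
  fun_prop

theorem continuous_profileKernel {d : ℝ} (hd : 1 ≤ d) (σ a : ℝ) {h : ℂ → ℝ} (hh : Continuous h) :
    Continuous fun p : ℝ × ℝ × ℂ × ℂ => profileKernel d σ a h p.1 p.2.1 p.2.2 := by
  have h1 : Continuous fun p : ℝ × ℝ × ℂ × ℂ => p.1 ^ (d - 1) :=
    (Real.continuous_rpow_const (by linarith)).comp continuous_fst
  have h2 : Continuous fun p : ℝ × ℝ × ℂ × ℂ => profileForcing σ a h p.2.1 p.2.2 :=
    (continuous_profileForcing σ a hh).comp continuous_snd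
  exact (by fun_prop : Continuous fun p : ℝ × ℝ × ℂ × ℂ => p.2.2.2).prodMk (h1.smul h2)

theorem exists_lipschitz_profileKernel {d σ a m : ℝ} (hd : 1 ≤ d) (hσ : 1 / 2 < σ) (ha : 0 < a)
    (hm : 0 ≤ m) (T : ℝ) : ∃ L : ℝ, 0 ≤ L ∧ ∀ t ∈ Icc (0 : ℝ) 1, ∀ s ∈ Icc 0 T, ∀ x y,
      ‖profileKernel d σ a (truncPow (2 * σ) m) t s x
        - profileKernel d σ a (truncPow (2 * σ) m) t s y‖ ≤ L * ‖x - y‖ := by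
  set N : ℝ := m ^ (2 * σ) + 2 * σ * m ^ (2 * σ - 1) * m
  have hN : 0 ≤ N := by positivity
  refine ⟨1 + a * (1 / σ + |T|) + N, by positivity, fun t ht s hs x y => ?_⟩
  have hσ0 : 0 < σ := by linarith
  have h1 : ‖x.1 - y.1‖ ≤ ‖x - y‖ := norm_fst_le (x - y)
  have h2 : ‖x.2 - y.2‖ ≤ ‖x - y‖ := norm_snd_le (x - y)
  have hforce : ‖profileForcing σ a (truncPow (2 * σ) m) s x
      - profileForcing σ a (truncPow (2 * σ) m) s y‖ ≤
        (1 + a * (1 / σ + |T|) + N) * ‖x - y‖ := by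
    have e : profileForcing σ a (truncPow (2 * σ) m) s x
      - profileForcing σ a (truncPow (2 * σ) m) s y = (x.1 - y.1)
        - Complex.I * (a : ℂ) * ((x.1 - y.1) / (σ : ℂ) + (s : ℂ) * (x.2 - y.2))
        - ((truncPow (2 * σ) m x.1 : ℂ) * x.1 - (truncPow (2 * σ) m y.1 : ℂ) * y.1) := by
      simp only [profileForcing]; ring
    have hmid : ‖Complex.I * (a : ℂ) * ((x.1 - y.1) / (σ : ℂ) + (s : ℂ) * (x.2 - y.2))‖ ≤
        a * (1 / σ + |T|) * ‖x - y‖ := by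
      rw [norm_mul, norm_mul, Complex.norm_I, one_mul, Complex.norm_of_nonneg ha.le, mul_assoc]
      refine mul_le_mul_of_nonneg_left ((norm_add_le _ _).trans ?_) ha.le
      rw [norm_div, norm_mul, Complex.norm_of_nonneg hσ0.le, Complex.norm_of_nonneg hs.1, add_mul,
        div_eq_mul_one_div, mul_comm _ (1 / σ)]
      have : s ≤ |T| := hs.2.trans (le_abs_self _)
      gcongr
    have hnl := (norm_truncPow_mul_sub_le (p := 2 * σ) (by linarith) hm x.1 y.1).trans
      (mul_le_mul_of_nonneg_left h1 hN)
    rw [e]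
    refine (norm_sub_le _ _).trans ?_
    refine (add_le_add ((norm_sub_le _ _).trans (add_le_add h1 hmid)) hnl).trans_eq ?_
    ring
  refine max_le ?_ ?_
  · refine h2.trans (le_mul_of_one_le_left (norm_nonneg _) ?_)
    have : 0 ≤ a * (1 / σ + |T|) := by positivity
    linarith
  · change ‖t ^ (d - 1) • _ - t ^ (d - 1) • _‖ ≤ _
    rw [← smul_sub, norm_smul, Real.norm_of_nonneg (Real.rpow_nonneg ht.1 _)]
    exact (mul_le_of_le_one_left (norm_nonneg _)
      (Real.rpow_le_one ht.1 ht.2 (by linarith))).trans hforce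

/-! ### Radial means and regularity up to the origin. -/

theorem hasDerivAt_id_smul_zero {W : ℝ → ℂ} (hW : ContinuousAt W 0) :
    HasDerivAt (fun ξ => ξ • W ξ) (W 0) 0 := by
  rw [hasDerivAt_iff_tendsto_slope]
  refine (hW.tendsto.mono_left nhdsWithin_le_nhds).congr' ?_
  filter_upwards [self_mem_nhdsWithin] with ξ hξ
  have : ξ ≠ 0 := hξ
  simp [slope, this]

section RadialMean

variable {d : ℝ} {g : ℝ → ℂ}

theorem continuous_radialMean (hd : 1 ≤ d) (hg : Continuous g) :
    Continuous fun ξ : ℝ => ∫ t in (0 : ℝ)..1, t ^ (d - 1) • g (ξ * t) := by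
  refine intervalIntegral.continuous_parametric_intervalIntegral_of_continuous' ?_ 0 1
  have h1 : Continuous fun p : ℝ × ℝ => p.2 ^ (d - 1) :=
    (Real.continuous_rpow_const (by linarith)).comp continuous_snd
  exact h1.smul (hg.comp (by fun_prop))

theorem smul_radialMean_eq {ξ : ℝ} (hξ : 0 < ξ) :
    ξ • ∫ t in (0 : ℝ)..1, t ^ (d - 1) • g (ξ * t) =
      ξ ^ (-(d - 1)) • ∫ s in (0 : ℝ)..ξ, s ^ (d - 1) • g s := by
  have h := intervalIntegral.smul_integral_comp_mul_left (a := 0) (b := 1)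
    (fun s : ℝ => s ^ (d - 1) • g s) ξ
  rw [mul_zero, mul_one] at h
  rw [← h, smul_comm]
  congr 1
  rw [← intervalIntegral.integral_smul]
  refine intervalIntegral.integral_congr fun t ht => ?_
  rw [uIcc_of_le zero_le_one] at ht
  rw [smul_smul, Real.mul_rpow hξ.le ht.1, ← mul_assoc, ← Real.rpow_add hξ]
  simp

theorem hasDerivAt_smul_radialMean (hd : 1 ≤ d) (hg : Continuous g) {ξ : ℝ} (hξ : 0 ≤ ξ) :
    HasDerivAt (fun ξ : ℝ => ξ • ∫ t in (0 : ℝ)..1, t ^ (d - 1) • g (ξ * t))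
      (g ξ - (d - 1) • ∫ t in (0 : ℝ)..1, t ^ (d - 1) • g (ξ * t)) ξ := by
  rcases hξ.eq_or_lt with rfl | hξ
  -- At the origin the mean equals `g 0 / d`, and `g 0 - (d - 1) • (g 0 / d)` is again `g 0 / d`.
  · have h := hasDerivAt_id_smul_zero (continuous_radialMean hd hg).continuousAt
    convert h using 1
    simp only [zero_mul]
    rw [intervalIntegral.integral_smul_const, integral_rpow (Or.inl (by linarith)),
      sub_add_cancel, Real.one_rpow, Real.zero_rpow (by linarith), smul_smul, sub_zero]
    nth_rewrite 1 [← one_smul ℝ (g 0)]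
    rw [← sub_smul]
    congr 1
    field_simp
    ring
  · have hc : Continuous fun s : ℝ => s ^ (d - 1) • g s :=
      (Real.continuous_rpow_const (by linarith)).smul hg
    have h1 : HasDerivAt (fun ξ : ℝ => ∫ s in (0 : ℝ)..ξ, s ^ (d - 1) • g s)
        (ξ ^ (d - 1) • g ξ) ξ :=
      intervalIntegral.integral_hasDerivAt_right (hc.intervalIntegrable _ _)
        hc.stronglyMeasurable.stronglyMeasurableAtFilter hc.continuousAt
    have h2 : HasDerivAt (fun ξ : ℝ => ξ ^ (-(d - 1))) (-(d - 1) * ξ ^ (-(d - 1) - 1)) ξ :=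
      Real.hasDerivAt_rpow_const (Or.inl hξ.ne')
    have h3 := h2.smul h1
    have h4 : HasDerivAt (fun ξ : ℝ => ξ • ∫ t in (0 : ℝ)..1, t ^ (d - 1) • g (ξ * t)) _ ξ :=
      h3.congr_of_eventuallyEq <| by
        filter_upwards [lt_mem_nhds hξ] with s hs using smul_radialMean_eq hs
    convert h4 using 1
    have h5 := smul_radialMean_eq (d := d) (g := g) hξ
    rw [smul_smul, ← Real.rpow_add hξ, neg_add_cancel, Real.rpow_zero, one_smul,
      Real.rpow_sub hξ, Real.rpow_one, sub_eq_add_neg]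
    congr 1
    rw [mul_div_assoc', div_eq_mul_inv, mul_right_comm, mul_smul _ (ξ ^ _), ← h5, smul_smul,
      mul_assoc, inv_mul_cancel₀ hξ.ne', mul_one, neg_smul]

end RadialMean

section Regularity

variable {d σ a : ℝ} {h : ℂ → ℝ} {x : ℝ → ℂ × ℂ} {q₀ : ℂ}

theorem profile_eq_of_volterraMap_eq (hd : 1 ≤ d) (hh : Continuous h) (hx : Continuous x) {s : ℝ}
    (hs : volterraMap (profileKernel d σ a h) (q₀, 0) x s = x s) :
    (x s).1 = q₀ + s • ∫ t in (0 : ℝ)..1, (x (s * t)).2 ∧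
    (x s).2 = s • ∫ t in (0 : ℝ)..1, t ^ (d - 1) • profileForcing σ a h (s * t) (x (s * t)) := by
  have hc : Continuous fun t : ℝ => profileKernel d σ a h t (s * t) (x (s * t)) :=
    (continuous_profileKernel hd σ a hh).comp
      (f := fun t : ℝ => (t, s * t, x (s * t))) (by fun_prop)
  have hi := hc.intervalIntegrable (μ := MeasureTheory.volume) 0 1
  have e1 := (ContinuousLinearMap.fst ℝ ℂ ℂ).intervalIntegral_comp_comm hi
  have e2 := (ContinuousLinearMap.snd ℝ ℂ ℂ).intervalIntegral_comp_comm hi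
  simp only [ContinuousLinearMap.coe_fst', ContinuousLinearMap.coe_snd', profileKernel] at e1 e2
  refine ⟨?_, ?_⟩
  · rw [e1]
    exact (congrArg Prod.fst hs).symm
  · rw [e2]
    refine (congrArg Prod.snd hs).symm.trans ?_
    exact zero_add _

theorem contDiffOn_two_of_hasDerivAt {Q P S : ℝ → ℂ} (hQ : ∀ ξ, 0 ≤ ξ → HasDerivAt Q (P ξ) ξ)
    (hP : ∀ ξ, 0 ≤ ξ → HasDerivAt P (S ξ) ξ) (hS : Continuous S) : ContDiffOn ℝ 2 Q (Ici 0) := by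
  have hu : UniqueDiffOn ℝ (Ici (0 : ℝ)) := uniqueDiffOn_Ici 0
  have h1 : ContDiffOn ℝ 1 P (Ici 0) := by
    rw [show (1 : WithTop ℕ∞) = 0 + 1 from (zero_add 1).symm, contDiffOn_succ_iff_derivWithin hu]
    refine ⟨fun ξ hξ => (hP ξ hξ).differentiableAt.differentiableWithinAt, by simp, ?_⟩
    rw [contDiffOn_zero]
    exact hS.continuousOn.congr fun ξ hξ => (hP ξ hξ).hasDerivWithinAt.derivWithin (hu ξ hξ)
  rw [show (2 : WithTop ℕ∞) = 1 + 1 from one_add_one_eq_two.symm,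
    contDiffOn_succ_iff_derivWithin hu]
  exact ⟨fun ξ hξ => (hQ ξ hξ).differentiableAt.differentiableWithinAt, by simp,
    h1.congr fun ξ hξ => (hQ ξ hξ).hasDerivWithinAt.derivWithin (hu ξ hξ)⟩

/-- A solution of the Volterra equation solves the profile equation where it is valid; the
comparison functions `Q`, `P` are defined on the whole line. -/
theorem exists_hasDerivAt_of_volterraMap_eq (hd : 1 ≤ d) (hh : Continuous h) (hx : Continuous x) :
    ∃ Q P S : ℝ → ℂ, Continuous S ∧ Q 0 = q₀ ∧ P 0 = 0 ∧
      (∀ s, volterraMap (profileKernel d σ a h) (q₀, 0) x s = x s → P s = (x s).2) ∧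
      (∀ T, (∀ s ∈ Icc 0 T, volterraMap (profileKernel d σ a h) (q₀, 0) x s = x s) →
        ∀ s ∈ Icc 0 T, Q s = (x s).1) ∧
      (∀ ξ, 0 ≤ ξ → HasDerivAt Q (P ξ) ξ) ∧ (∀ ξ, 0 ≤ ξ → HasDerivAt P (S ξ) ξ) ∧
      ∀ ξ, 0 < ξ → S ξ = profileForcing σ a h ξ (x ξ) - ((d - 1) / ξ) • P ξ := by
  set g : ℝ → ℂ := fun s => profileForcing σ a h s (x s)
  have hg : Continuous g :=
    (continuous_profileForcing σ a hh).comp (f := fun s : ℝ => (s, x s)) (by fun_prop)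
  set W : ℝ → ℂ := fun ξ => ∫ t in (0 : ℝ)..1, t ^ (d - 1) • g (ξ * t)
  have hW : Continuous W := continuous_radialMean hd hg
  set P : ℝ → ℂ := fun ξ => ξ • W ξ
  have hPc : Continuous P := continuous_id.smul hW
  have hPx : ∀ s, volterraMap (profileKernel d σ a h) (q₀, 0) x s = x s → P s = (x s).2 :=
    fun s hs => (profile_eq_of_volterraMap_eq hd hh hx hs).2.symm
  -- `Q` is rebuilt as a primitive of `P`: the Volterra equation is only available for `s ≥ 0`,
  -- while a two-sided derivative is wanted at `0`.
  refine ⟨fun ξ => q₀ + ∫ s in (0 : ℝ)..ξ, P s, P, fun ξ => g ξ - (d - 1) • W ξ,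
    hg.sub (show Continuous fun ξ => (d - 1) • W ξ from hW.const_smul (d - 1)), by simp, by simp [P], hPx, fun T hT s hs => ?_, fun ξ _ => ?_,
    fun ξ hξ => hasDerivAt_smul_radialMean hd hg hξ, fun ξ hξ => ?_⟩
  · rw [(profile_eq_of_volterraMap_eq hd hh hx (hT s hs)).1]
    have e := intervalIntegral.smul_integral_comp_mul_left (a := 0) (b := 1) P s
    rw [mul_zero, mul_one] at e
    simp only
    rw [← e]
    congr 2
    refine intervalIntegral.integral_congr fun t ht => ?_
    rw [uIcc_of_le zero_le_one] at ht
    exact hPx _ (hT _ ⟨mul_nonneg hs.1 ht.1, (mul_le_of_le_one_right hs.1 ht.2).trans hs.2⟩)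
  · exact (intervalIntegral.integral_hasDerivAt_right (hPc.intervalIntegrable _ _)
      hPc.stronglyMeasurable.stronglyMeasurableAtFilter hPc.continuousAt).const_add q₀
  · simp only [P, smul_smul, div_mul_cancel₀ _ hξ.ne', g]

end Regularity

/-! ### Grönwall's inequality and real coordinates. -/

/-- The product `f * exp (-φ)` is nonincreasing. No sign of `f` is required. -/
theorem le_mul_exp_of_hasDerivAt_le {f f' φ φ' : ℝ → ℝ} {α β : ℝ} (hαβ : α ≤ β)
    (hf : ∀ x ∈ Icc α β, HasDerivAt f (f' x) x) (hφ : ∀ x ∈ Icc α β, HasDerivAt φ (φ' x) x)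
    (h : ∀ x ∈ Ioo α β, f' x ≤ φ' x * f x) : f β ≤ f α * Real.exp (φ β - φ α) := by
  have hd : ∀ x ∈ Icc α β, HasDerivAt (fun x => f x * Real.exp (-φ x))
      (f' x * Real.exp (-φ x) + f x * (Real.exp (-φ x) * -φ' x)) x :=
    fun x hx => (hf x hx).mul (hφ x hx).neg.exp
  have hanti : AntitoneOn (fun x => f x * Real.exp (-φ x)) (Icc α β) := by
    refine antitoneOn_of_deriv_nonpos (convex_Icc α β)
      (fun x hx => (hd x hx).continuousAt.continuousWithinAt)
      (fun x hx => (hd x (interior_subset hx)).differentiableAt.differentiableWithinAt)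
      fun x hx => ?_
    rw [(hd x (interior_subset hx)).deriv]
    rw [interior_Icc] at hx
    nlinarith [h x hx, Real.exp_pos (-φ x)]
  have := hanti (left_mem_Icc.2 hαβ) (right_mem_Icc.2 hαβ) hαβ
  simp only at this
  rw [sub_eq_neg_add, Real.exp_add, ← mul_assoc]
  have h1 := mul_le_mul_of_nonneg_right this (Real.exp_pos (φ β)).le
  rwa [mul_assoc, ← Real.exp_add, neg_add_cancel, Real.exp_zero, mul_one] at h1

section ComplexDeriv

variable {f g : ℝ → ℂ} {f' g' : ℂ} {t : ℝ}

theorem hasDerivAt_complex_re (hf : HasDerivAt f f' t) : HasDerivAt (fun t => (f t).re) f'.re t :=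
  Complex.reCLM.hasFDerivAt.comp_hasDerivAt t hf

theorem hasDerivAt_complex_im (hf : HasDerivAt f f' t) : HasDerivAt (fun t => (f t).im) f'.im t :=
  Complex.imCLM.hasFDerivAt.comp_hasDerivAt t hf

theorem hasDerivAt_complex_normSq (hf : HasDerivAt f f' t) :
    HasDerivAt (fun t => Complex.normSq (f t)) (2 * ((f t).re * f'.re + (f t).im * f'.im)) t := by
  have h := ((hasDerivAt_complex_re hf).mul (hasDerivAt_complex_re hf)).add
    ((hasDerivAt_complex_im hf).mul (hasDerivAt_complex_im hf))
  simp only [Complex.normSq_apply]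
  exact h.congr_deriv (by ring)

end ComplexDeriv

theorem profileForcing_re (σ a : ℝ) (h : ℂ → ℝ) (s : ℝ) (x : ℂ × ℂ) :
    (profileForcing σ a h s x).re = x.1.re + a * (x.1.im / σ + s * x.2.im) - h x.1 * x.1.re := by
  simp [profileForcing]

theorem profileForcing_im (σ a : ℝ) (h : ℂ → ℝ) (s : ℝ) (x : ℂ × ℂ) :
    (profileForcing σ a h s x).im = x.1.im - a * (x.1.re / σ + s * x.2.re) - h x.1 * x.1.im := by
  simp [profileForcing]

theorem truncPow_eq_sqrt_normSq (p m : ℝ) (z : ℂ) :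
    truncPow p m z = min (√(Complex.normSq z)) m ^ p := by
  rw [truncPow, Complex.norm_def]

/-! ### The a priori bound and global existence. -/

section APriori

variable {d σ a m T : ℝ}

/-- In the derivative of `(|P|² + |Q|² + F(|Q|²)) / 2` the nonlinear terms cancel, the term `i a ξ
P` is orthogonal to `P`, and the radial damping has a good sign. What is left is quadratic in `(Q,
P)` with coefficients free of `m`, so the bound does not depend on the truncation. -/
theorem norm_le_of_profileODE (hd : 1 ≤ d) (hσ : 0 < σ) (ha : 0 < a) (hm : 0 ≤ m)
    {Q P S : ℝ → ℂ} (hQ0 : Q 0 = 1) (hP0 : P 0 = 0)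
    (hQ : ∀ ξ ∈ Icc 0 T, HasDerivAt Q (P ξ) ξ) (hP : ∀ ξ ∈ Icc 0 T, HasDerivAt P (S ξ) ξ)
    (hS : ∀ ξ ∈ Ioc 0 T, S ξ = profileForcing σ a (truncPow (2 * σ) m) ξ (Q ξ, P ξ)
      - ((d - 1) / ξ) • P ξ) :
    ∀ ξ ∈ Icc 0 T, ‖Q ξ‖ ≤ 2 * Real.exp ((2 + a / σ) * ξ) := by
  intro ξ hξ
  set η : ℝ → ℝ := fun r => min (√r) m ^ (2 * σ)
  have hη : Continuous η :=
    (Real.continuous_rpow_const (by linarith)).comp (Real.continuous_sqrt.min continuous_const)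
  have hη0 : ∀ r, 0 ≤ η r := fun r => Real.rpow_nonneg (le_min (Real.sqrt_nonneg r) hm) _
  have hη1 : ∀ r ≤ 1, η r ≤ 1 := fun r hr => Real.rpow_le_one (le_min (Real.sqrt_nonneg r) hm)
    ((min_le_left _ _).trans (Real.sqrt_le_one.2 hr)) (by linarith)
  set F : ℝ → ℝ := fun ρ => ∫ r in (0 : ℝ)..ρ, η r
  have hF : ∀ ρ, HasDerivAt F (η ρ) ρ := fun ρ =>
    intervalIntegral.integral_hasDerivAt_right (hη.intervalIntegrable _ _)
      hη.stronglyMeasurable.stronglyMeasurableAtFilter hη.continuousAt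
  have hF0 : ∀ ρ, 0 ≤ ρ → 0 ≤ F ρ := fun ρ hρ =>
    intervalIntegral.integral_nonneg hρ fun r _ => hη0 r
  have hF1 : F 1 ≤ 1 := by
    have := intervalIntegral.integral_mono_on (zero_le_one' ℝ) (hη.intervalIntegrable 0 1)
      (intervalIntegrable_const (μ := MeasureTheory.volume) (c := (1 : ℝ)))
      fun r hr => hη1 r hr.2
    simpa using this
  set En : ℝ → ℝ := fun t =>
    (Complex.normSq (P t) + Complex.normSq (Q t) + F (Complex.normSq (Q t))) / 2
  have hEn : ∀ t ∈ Icc 0 ξ, HasDerivAt En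
      ((2 * ((P t).re * (S t).re + (P t).im * (S t).im)
        + 2 * ((Q t).re * (P t).re + (Q t).im * (P t).im)
        + η (Complex.normSq (Q t)) * (2 * ((Q t).re * (P t).re + (Q t).im * (P t).im))) / 2) t := by
    intro t ht
    have ht' : t ∈ Icc 0 T := ⟨ht.1, ht.2.trans hξ.2⟩
    have hq := hasDerivAt_complex_normSq (hQ t ht')
    exact (((hasDerivAt_complex_normSq (hP t ht')).add hq).add ((hF _).comp t hq)).div_const 2
  have hlin : ∀ t ∈ Icc 0 ξ,
      HasDerivAt (fun t => (2 + a / σ) * t) ((fun _ => 2 + a / σ) t) t := fun t _ => by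
    simpa using (hasDerivAt_id t).const_mul (2 + a / σ)
  have hgr := le_mul_exp_of_hasDerivAt_le hξ.1 hEn hlin fun t ht => by
    have ht' : t ∈ Ioc 0 T := ⟨ht.1, ht.2.le.trans hξ.2⟩
    have e := hS t ht'
    have ere := congrArg Complex.re e
    have eim := congrArg Complex.im e
    rw [Complex.sub_re, profileForcing_re, Complex.smul_re, smul_eq_mul,
      truncPow_eq_sqrt_normSq] at ere
    rw [Complex.sub_im, profileForcing_im, Complex.smul_im, smul_eq_mul,
      truncPow_eq_sqrt_normSq] at eim
    have hk : 0 ≤ (d - 1) / t := div_nonneg (by linarith) ht.1.le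
    have hb : 0 ≤ a / σ := by positivity
    have hFp := hF0 _ (Complex.normSq_nonneg (Q t))
    simp only [En]
    rw [ere, eim]
    simp only [η, div_eq_mul_inv] at *
    generalize F (Complex.normSq (Q t)) = Fv at *
    generalize min (√(Complex.normSq (Q t))) m ^ (2 * σ) = hv at *
    simp only [Complex.normSq_apply]
    generalize (d - 1) * t⁻¹ = k at *
    generalize (Q t).re = u at *
    generalize (Q t).im = v at *
    generalize (P t).re = p at *
    generalize (P t).im = q at *
    have hcF : 0 ≤ (2 + a * σ⁻¹) * Fv := mul_nonneg (by linarith) hFp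
    have hkP : 0 ≤ k * (p * p + q * q) :=
      mul_nonneg hk (add_nonneg (mul_self_nonneg p) (mul_self_nonneg q))
    -- This square absorbs the cross term `(a / σ) (v p - u q)` coming from `i a Q / σ`; the squares
    -- given to `nlinarith` absorb `2 (u p + v q)`.
    have h1 : 0 ≤ (a * σ⁻¹) * ((p - v) ^ 2 + (q + u) ^ 2) :=
      mul_nonneg hb (by positivity)
    nlinarith [sq_nonneg (p - u), sq_nonneg (q - v)]
  have hE0 : En 0 ≤ 1 := by
    simp only [En, hQ0, hP0, map_zero, map_one]
    linarith
  have hexp : 1 ≤ Real.exp ((2 + a / σ) * ξ) := Real.one_le_exp (by have := hξ.1; positivity)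
  have hEξ : Complex.normSq (Q ξ) / 2 ≤ En ξ := by
    simp only [En]
    linarith [Complex.normSq_nonneg (P ξ), hF0 _ (Complex.normSq_nonneg (Q ξ))]
  rw [mul_zero, sub_zero] at hgr
  have hfin : ‖Q ξ‖ ^ 2 ≤ 2 * Real.exp ((2 + a / σ) * ξ) := by
    rw [← Complex.normSq_eq_norm_sq]
    nlinarith
  nlinarith [norm_nonneg (Q ξ)]

theorem volterraMap_profileKernel_congr {h h' : ℂ → ℝ} {x y : ℝ → ℂ × ℂ} {x₀ : ℂ × ℂ} {s : ℝ}
    (hs : 0 ≤ s) (hxy : ∀ u ∈ Icc 0 s, x u = y u) (hh : ∀ u ∈ Icc 0 s, h (x u).1 = h' (x u).1) :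
    volterraMap (profileKernel d σ a h) x₀ x s = volterraMap (profileKernel d σ a h') x₀ y s := by
  unfold volterraMap
  congr 2
  refine intervalIntegral.integral_congr fun t ht => ?_
  rw [uIcc_of_le zero_le_one] at ht
  have hu : s * t ∈ Icc 0 s := ⟨mul_nonneg hs ht.1, mul_le_of_le_one_right hs ht.2⟩
  simp only [profileKernel, profileForcing, hh _ hu]
  rw [hxy _ hu]

theorem norm_fst_le_of_volterraMap_eq (hd : 1 ≤ d) (hσ : 0 < σ) (ha : 0 < a) (hm : 0 ≤ m)
    {x : ℝ → ℂ × ℂ} (hx : Continuous x)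
    (hV : ∀ s ∈ Icc 0 T,
      volterraMap (profileKernel d σ a (truncPow (2 * σ) m)) (1, 0) x s = x s) :
    ∀ s ∈ Icc 0 T, ‖(x s).1‖ ≤ 2 * Real.exp ((2 + a / σ) * s) := by
  obtain ⟨Q, P, S, -, hQ0, hP0, hPx, hQx, hQ, hP, hS⟩ := exists_hasDerivAt_of_volterraMap_eq
    (σ := σ) (a := a) (q₀ := 1) hd (continuous_truncPow (p := 2 * σ) (m := m) (by linarith)) hx
  intro s hs
  rw [← hQx T hV s hs]
  refine norm_le_of_profileODE hd hσ ha hm hQ0 hP0 (fun ξ hξ => hQ ξ hξ.1)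
    (fun ξ hξ => hP ξ hξ.1) (fun ξ hξ => ?_) s hs
  have hξ' : ξ ∈ Icc 0 T := ⟨hξ.1.le, hξ.2⟩
  rw [hS ξ hξ.1, hQx T hV ξ hξ', hPx ξ (hV ξ hξ')]

theorem exists_global_profileODE (hd : 1 ≤ d) (hσ : 1 / 2 < σ) (ha : 0 < a) :
    ∃ Q P S : ℝ → ℂ, Continuous S ∧ Q 0 = 1 ∧ P 0 = 0 ∧
      (∀ ξ, 0 ≤ ξ → HasDerivAt Q (P ξ) ξ) ∧ (∀ ξ, 0 ≤ ξ → HasDerivAt P (S ξ) ξ) ∧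
      ∀ ξ, 0 < ξ → S ξ = profileForcing σ a (fun z => ‖z‖ ^ (2 * σ)) ξ (Q ξ, P ξ)
        - ((d - 1) / ξ) • P ξ := by
  have hσ0 : 0 < σ := by linarith
  set c := 2 + a / σ
  have hc : 0 ≤ c := by positivity
  -- The truncation level on `[0, n]` is the a priori bound at the endpoint `n`.
  set M : ℕ → ℝ := fun n => 2 * Real.exp (c * n)
  have hM : ∀ n, 0 ≤ M n := fun n => by positivity
  have hMb : ∀ (n : ℕ) (s : ℝ), s ≤ n → 2 * Real.exp (c * s) ≤ M n := fun n s hs => by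
    simp only [M]; gcongr
  have hex : ∀ n : ℕ, ∃ x : ℝ → ℂ × ℂ, Continuous x ∧ ∀ s ∈ Icc 0 (n : ℝ),
      volterraMap (profileKernel d σ a (truncPow (2 * σ) (M n))) (1, 0) x s = x s := fun n => by
    obtain ⟨L, hL, hLip⟩ := exists_lipschitz_profileKernel hd hσ ha (hM n) n
    exact exists_volterraMap_eq
      (continuous_profileKernel hd σ a (continuous_truncPow (by linarith))) hL n.cast_nonneg hLip _
  choose X hXc hXV using hex
  have hXb : ∀ n : ℕ, ∀ s ∈ Icc 0 (n : ℝ), ‖(X n s).1‖ ≤ 2 * Real.exp (c * s) := fun n =>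
    norm_fst_le_of_volterraMap_eq hd hσ0 ha (hM n) (hXc n) (hXV n)
  have hagree : ∀ n k : ℕ, n ≤ k → EqOn (X n) (X k) (Icc 0 (n : ℝ)) := fun n k hnk => by
    have hnk' : (n : ℝ) ≤ k := by exact_mod_cast hnk
    obtain ⟨L, hL, hLip⟩ := exists_lipschitz_profileKernel (d := d) hd hσ ha (hM k) n
    refine eqOn_of_volterraMap_eq
      (continuous_profileKernel hd σ a (continuous_truncPow (by linarith))) hL hLip (1, 0)
      (hXc n) (hXc k) (fun s hs => ?_) (fun s hs => hXV k s ⟨hs.1, hs.2.trans hnk'⟩)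
    -- On `[0, n]` the function `X n` lies below both levels `M n` and `M k`, so it also solves the
    -- equation truncated at `M k`, and uniqueness applies.
    refine Eq.trans ?_ (hXV n s hs)
    refine volterraMap_profileKernel_congr hs.1 (fun _ _ => rfl) fun u hu => ?_
    have hu' : u ≤ n := hu.2.trans hs.2
    have hb := hXb n u ⟨hu.1, hu'⟩
    rw [truncPow_of_le (hb.trans (hMb k u (hu'.trans hnk'))), truncPow_of_le (hb.trans (hMb n u hu'))]
  -- The index `⌊|ξ|⌋₊ + 1` exceeds `|ξ|`; the absolute value extends `Y` evenly, hence
  -- continuously, to the whole line.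
  set Y : ℝ → ℂ × ℂ := fun ξ => X (⌊|ξ|⌋₊ + 1) |ξ|
  have hY : ∀ (n : ℕ) (ξ : ℝ), |ξ| < n → Y ξ = X n |ξ| := fun n ξ hξ => by
    have h1 : ⌊|ξ|⌋₊ + 1 ≤ n := Nat.succ_le_of_lt ((Nat.floor_lt (abs_nonneg ξ)).2 hξ)
    exact hagree _ n h1 ⟨abs_nonneg ξ, by exact_mod_cast (Nat.lt_floor_add_one |ξ|).le⟩
  have hYc : Continuous Y := continuous_iff_continuousAt.2 fun ξ => by
    obtain ⟨n, hn⟩ := exists_nat_gt |ξ|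
    refine ((hXc n).comp continuous_abs).continuousAt.congr ?_
    filter_upwards [continuous_abs.continuousAt.eventually (gt_mem_nhds hn)] with s hs
    exact (hY n s hs).symm
  have hYV : ∀ s, 0 ≤ s →
      volterraMap (profileKernel d σ a fun z => ‖z‖ ^ (2 * σ)) (1, 0) Y s = Y s := fun s hs => by
    obtain ⟨n, hn⟩ := exists_nat_gt s
    have hYn : ∀ u ∈ Icc 0 s, Y u = X n u := fun u hu => by
      have := hY n u (by rw [abs_of_nonneg hu.1]; exact hu.2.trans_lt hn)
      rwa [abs_of_nonneg hu.1] at this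
    rw [hYn s ⟨hs, le_rfl⟩]
    refine Eq.trans ?_ (hXV n s ⟨hs, hn.le⟩)
    refine volterraMap_profileKernel_congr hs hYn fun u hu => ?_
    have hu' : u ≤ n := hu.2.trans hn.le
    rw [hYn u hu, truncPow_of_le ((hXb n u ⟨hu.1, hu'⟩).trans (hMb n u hu'))]
  obtain ⟨Q, P, S, hSc, hQ0, hP0, hPx, hQx, hQ, hP, hS⟩ := exists_hasDerivAt_of_volterraMap_eq
    (σ := σ) (a := a) (q₀ := 1) (h := fun z => ‖z‖ ^ (2 * σ)) hd
    ((Real.continuous_rpow_const (by linarith)).comp continuous_norm) hYc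
  refine ⟨Q, P, S, hSc, hQ0, hP0, hQ, hP, fun ξ hξ => ?_⟩
  rw [hS ξ hξ, hQx ξ (fun s hs => hYV s hs.1) ξ ⟨hξ.le, le_rfl⟩, hPx ξ (hYV ξ hξ.le)]

end APriori

/-! ### Boundedness for the rescaled equation. -/

theorem exists_neg_le_add_rpow {σ : ℝ} (hσ : 0 < σ) (c : ℝ) :
    ∃ C, 0 ≤ C ∧ ∀ ρ, 0 ≤ ρ → -C ≤ c * ρ / 2 + ρ ^ (σ + 1) / (2 * (σ + 1)) := by
  -- Beyond `ρ₀` the power `ρ ^ (σ + 1) / (2 (σ + 1))` dominates `|c| ρ / 2`.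
  set ρ₀ := ((σ + 1) * |c|) ^ (1 / σ)
  have hρ₀ : 0 ≤ ρ₀ := by positivity
  refine ⟨|c| * ρ₀ / 2, by positivity, fun ρ hρ => ?_⟩
  have h1 : -(|c| * ρ) ≤ c * ρ := by nlinarith [neg_abs_le c]
  have e : ρ ^ (σ + 1) / (2 * (σ + 1)) = ρ ^ σ * ρ / (2 * (σ + 1)) := by
    rw [Real.rpow_add' hρ (by linarith), Real.rpow_one]
  rcases le_total ρ ρ₀ with h | h
  · have h2 : 0 ≤ ρ ^ (σ + 1) / (2 * (σ + 1)) := by positivity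
    nlinarith [mul_le_mul_of_nonneg_left h (abs_nonneg c)]
  · have h2 : (σ + 1) * |c| ≤ ρ ^ σ := by
      refine le_trans (le_of_eq ?_) (Real.rpow_le_rpow hρ₀ h hσ.le)
      rw [← Real.rpow_mul (by positivity), one_div, inv_mul_cancel₀ hσ.ne', Real.rpow_one]
    have h3 : |c| * ρ / 2 ≤ ρ ^ σ * ρ / (2 * (σ + 1)) := by
      rw [le_div_iff₀ (by positivity)]
      nlinarith [mul_le_mul_of_nonneg_right h2 hρ]
    have : 0 ≤ |c| * ρ₀ / 2 := by positivity
    rw [e]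
    linarith

section Rescaled

variable {σ a c : ℝ} {R V A : ℝ → ℂ}

/-- The decreasing energy of the rescaled profile bounds its derivative by its size. -/
theorem exists_normSq_deriv_le (hσ : 0 < σ)
    (hR : ∀ ξ, 0 < ξ → HasDerivAt R (V ξ) ξ) (hV : ∀ ξ, 0 < ξ → HasDerivAt V (A ξ) ξ)
    (hA : ∀ ξ, 0 < ξ → A ξ = (1 - (c + Complex.normSq (R ξ) ^ σ) / ξ ^ 2) • R ξ
      - Complex.I * ((a * ξ : ℝ) : ℂ) * V ξ) :
    ∃ K, 0 ≤ K ∧ ∀ ξ, 1 ≤ ξ → Complex.normSq (V ξ) ≤ Complex.normSq (R ξ) + 2 * K := by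
  obtain ⟨C, hC, hF⟩ := exists_neg_le_add_rpow hσ c
  set F : ℝ → ℝ := fun ρ => c * ρ / 2 + ρ ^ (σ + 1) / (2 * (σ + 1))
  have hFC : ∀ ρ, 0 ≤ ρ → 0 ≤ F ρ + C := fun ρ hρ => neg_le_iff_add_nonneg.1 (hF ρ hρ)
  have hF' : ∀ ρ, HasDerivAt F ((c + ρ ^ σ) / 2) ρ := fun ρ => by
    have h1 : HasDerivAt (fun ρ : ℝ => ρ ^ (σ + 1)) ((σ + 1) * ρ ^ (σ + 1 - 1)) ρ :=
      Real.hasDerivAt_rpow_const (Or.inr (by linarith))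
    have h2 := (((hasDerivAt_id ρ).const_mul c).div_const 2).add (h1.div_const (2 * (σ + 1)))
    refine h2.congr_deriv ?_
    rw [add_sub_cancel_right]
    field_simp
  -- The skew term `i a ξ V` does no work and the potential terms cancel, so only the derivative of
  -- `ξ ^ (-2)` survives; the shift by `C` gives it a sign.
  set En : ℝ → ℝ := fun ξ => (Complex.normSq (V ξ) - Complex.normSq (R ξ)) / 2
    + (F (Complex.normSq (R ξ)) + C) / ξ ^ 2
  have hEn : ∀ ξ, 0 < ξ → HasDerivAt En (-2 * (F (Complex.normSq (R ξ)) + C) / ξ ^ 3) ξ := by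
    intro ξ hξ
    have hr := hasDerivAt_complex_normSq (hR ξ hξ)
    have h := (((hasDerivAt_complex_normSq (hV ξ hξ)).sub hr).div_const 2).add
      ((((hF' _).comp ξ hr).add_const C).div (hasDerivAt_pow 2 ξ) (by positivity))
    refine h.congr_deriv ?_
    have ere := congrArg Complex.re (hA ξ hξ)
    have eim := congrArg Complex.im (hA ξ hξ)
    simp only [Complex.sub_re, Complex.sub_im, Complex.smul_re, Complex.smul_im, smul_eq_mul,
      Complex.mul_re, Complex.mul_im, Complex.I_re, Complex.I_im, Complex.ofReal_re,
      Complex.ofReal_im] at ere eim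
    rw [ere, eim]
    simp only [Function.comp_apply]
    field_simp
    ring
  refine ⟨|En 1|, abs_nonneg _, fun ξ hξ => ?_⟩
  have hgr := le_mul_exp_of_hasDerivAt_le (φ := fun _ => 0) (φ' := fun _ => 0) hξ
    (fun x hx => hEn x (by linarith [hx.1])) (fun x _ => hasDerivAt_const x 0) fun x hx => by
      have hx0 : 0 < x := by linarith [hx.1]
      rw [zero_mul, neg_mul, neg_div, neg_nonpos]
      exact div_nonneg (mul_nonneg zero_le_two (hFC _ (Complex.normSq_nonneg (R x))))
        (by positivity)
  rw [sub_self, Real.exp_zero, mul_one] at hgr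
  have h1 : 0 ≤ (F (Complex.normSq (R ξ)) + C) / ξ ^ 2 :=
    div_nonneg (hFC _ (Complex.normSq_nonneg (R ξ))) (by positivity)
  have h2 := hgr.trans (le_abs_self (En 1))
  change (Complex.normSq (V ξ) - Complex.normSq (R ξ)) / 2
    + (F (Complex.normSq (R ξ)) + C) / ξ ^ 2 ≤ |En 1| at h2
  linarith

theorem exists_normSq_le_of_rescaled (hσ : 0 < σ) (ha : 0 < a)
    (hR : ∀ ξ, 0 < ξ → HasDerivAt R (V ξ) ξ) (hV : ∀ ξ, 0 < ξ → HasDerivAt V (A ξ) ξ)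
    (hA : ∀ ξ, 0 < ξ → A ξ = (1 - (c + Complex.normSq (R ξ) ^ σ) / ξ ^ 2) • R ξ
      - Complex.I * ((a * ξ : ℝ) : ℂ) * V ξ) :
    ∃ ξ₁ C, ∀ ξ, ξ₁ ≤ ξ → Complex.normSq (R ξ) ≤ C := by
  obtain ⟨K, hK, hVK⟩ := exists_normSq_deriv_le hσ hR hV hA
  set J : ℝ → ℝ := fun ξ => (R ξ).re * (V ξ).im - (R ξ).im * (V ξ).re
  have hJ : ∀ ξ, 1 ≤ ξ → |J ξ| ≤ Complex.normSq (R ξ) + K := fun ξ hξ => by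
    have h := hVK ξ hξ
    simp only [Complex.normSq_apply] at *
    rw [abs_le]
    constructor <;>
      nlinarith [sq_nonneg ((R ξ).re + (V ξ).im), sq_nonneg ((R ξ).im - (V ξ).re),
        sq_nonneg ((R ξ).re - (V ξ).im), sq_nonneg ((R ξ).im + (V ξ).re)]
  -- The added constant makes `N` dominate `(a / 4) (|R|² + K)`, hence `(a / 4) |J|`, once `ξ ≥ max
  -- 1 (4 / a)`.
  set N : ℝ → ℝ := fun ξ => J ξ / ξ + a / 2 * Complex.normSq (R ξ) + (K + a / 4 * K)
  have hN' : ∀ ξ, 0 < ξ → HasDerivAt N (-J ξ / ξ ^ 2) ξ := by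
    intro ξ hξ
    have hRξ := hR ξ hξ
    have hVξ := hV ξ hξ
    have hJ' := ((hasDerivAt_complex_re hRξ).mul (hasDerivAt_complex_im hVξ)).sub
      ((hasDerivAt_complex_im hRξ).mul (hasDerivAt_complex_re hVξ))
    have h := ((hJ'.div (hasDerivAt_id ξ) hξ.ne').add
      ((hasDerivAt_complex_normSq hRξ).const_mul (a / 2))).add_const (K + a / 4 * K)
    refine h.congr_deriv ?_
    have ere := congrArg Complex.re (hA ξ hξ)
    have eim := congrArg Complex.im (hA ξ hξ)
    simp only [Complex.sub_re, Complex.sub_im, Complex.smul_re, Complex.smul_im, smul_eq_mul,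
      Complex.mul_re, Complex.mul_im, Complex.I_re, Complex.I_im, Complex.ofReal_re,
      Complex.ofReal_im] at ere eim
    rw [ere, eim]
    simp only [id, J, Pi.sub_apply, Pi.mul_apply]
    field_simp
    ring
  set ξ₁ := max 1 (4 / a)
  have h1ξ : 1 ≤ ξ₁ := le_max_left _ _
  have hNlow : ∀ ξ, ξ₁ ≤ ξ → a / 4 * (Complex.normSq (R ξ) + K) ≤ N ξ := by
    intro ξ hξ
    have h1 : 1 ≤ ξ := h1ξ.trans hξ
    have h4 : 4 ≤ ξ * a := (div_le_iff₀ ha).1 ((le_max_right _ _).trans hξ)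
    have hJξ := neg_le_of_abs_le (hJ ξ h1)
    have h5 : -(a / 4 * Complex.normSq (R ξ) + K) ≤ J ξ / ξ := by
      rw [le_div_iff₀ (by linarith)]
      nlinarith [mul_le_mul_of_nonneg_right h4 (Complex.normSq_nonneg (R ξ)),
        mul_le_mul_of_nonneg_right h1 hK]
    simp only [N]
    linarith
  refine ⟨ξ₁, 4 / a * (N ξ₁ * Real.exp (4 / a)), fun ξ hξ => ?_⟩
  -- The rate `(4 / a) / x ^ 2` has the primitive `-(4 / a) / x`, which grows by at most `4 / a` on
  -- `[ξ₁, ∞)` because `ξ₁ ≥ 1`.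
  have hgr := le_mul_exp_of_hasDerivAt_le (φ := fun x => -(4 / a) * x⁻¹)
    (φ' := fun x => -(4 / a) * -(x ^ 2)⁻¹) hξ
    (fun x hx => hN' x (by linarith [hx.1]))
    (fun x hx => (hasDerivAt_inv (by linarith [hx.1] : 0 < x).ne').const_mul _) fun x hx => by
      have hx0 : 0 < x := by linarith [hx.1]
      have hJx := neg_le_of_abs_le (hJ x (by linarith [hx.1]))
      have hl := hNlow x hx.1.le
      have h6 : -J x ≤ 4 / a * N x := by
        rw [div_mul_eq_mul_div, le_div_iff₀ ha]
        nlinarith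
      rw [div_eq_mul_inv]
      have := mul_le_mul_of_nonneg_right h6 (by positivity : 0 ≤ (x ^ 2)⁻¹)
      linarith
  have hN1 : 0 ≤ N ξ₁ := le_trans
    (mul_nonneg (by positivity) (add_nonneg (Complex.normSq_nonneg _) hK)) (hNlow ξ₁ le_rfl)
  have hexp : -(4 / a) * ξ⁻¹ - -(4 / a) * ξ₁⁻¹ ≤ 4 / a := by
    have h7 : 0 < 4 / a := by positivity
    have h8 : ξ₁⁻¹ ≤ 1 := inv_le_one_of_one_le₀ h1ξ
    have h9 : 0 ≤ ξ⁻¹ := inv_nonneg.2 (by linarith)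
    nlinarith [mul_nonneg h7.le h9, mul_le_mul_of_nonneg_left h8 h7.le]
  have hfin : N ξ ≤ N ξ₁ * Real.exp (4 / a) :=
    hgr.trans (mul_le_mul_of_nonneg_left (Real.exp_le_exp.2 hexp) hN1)
  have hl := (hNlow ξ hξ).trans hfin
  rw [div_mul_eq_mul_div, le_div_iff₀ ha]
  nlinarith [mul_nonneg ha.le hK]

end Rescaled

/-! ### The rescaling and the conclusion. -/

/-- In the case `d = 1 + 2 / σ`, the function `ξ ^ (1 / σ) Q` satisfies an equation without
damping. -/
theorem hasDerivAt_rescaled_profile {d σ a : ℝ} (hd : d - 1 = 2 * (1 / σ)) (hσ : 0 < σ)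
    {Q P S : ℝ → ℂ} {ξ : ℝ} (hξ : 0 < ξ) (hQ : HasDerivAt Q (P ξ) ξ) (hP : HasDerivAt P (S ξ) ξ)
    (hS : S ξ = profileForcing σ a (fun z => ‖z‖ ^ (2 * σ)) ξ (Q ξ, P ξ) - ((d - 1) / ξ) • P ξ) :
    HasDerivAt (fun ξ : ℝ => ξ ^ (1 / σ) • Q ξ) (ξ ^ (1 / σ) • (P ξ + (1 / σ / ξ) • Q ξ)) ξ ∧
    HasDerivAt (fun ξ : ℝ => ξ ^ (1 / σ) • (P ξ + (1 / σ / ξ) • Q ξ))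
      ((1 - (1 / σ - (1 / σ) ^ 2 + Complex.normSq (ξ ^ (1 / σ) • Q ξ) ^ σ) / ξ ^ 2) •
          (ξ ^ (1 / σ) • Q ξ)
        - Complex.I * ((a * ξ : ℝ) : ℂ) * (ξ ^ (1 / σ) • (P ξ + (1 / σ / ξ) • Q ξ))) ξ := by
  have hw : HasDerivAt (fun ξ : ℝ => ξ ^ (1 / σ)) (1 / σ / ξ * ξ ^ (1 / σ)) ξ := by
    refine (Real.hasDerivAt_rpow_const (Or.inl hξ.ne')).congr_deriv ?_
    rw [Real.rpow_sub hξ, Real.rpow_one]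
    ring
  have hi : HasDerivAt (fun ξ : ℝ => 1 / σ / ξ) (-(1 / σ) / ξ ^ 2) ξ := by
    simp only [div_eq_mul_inv (1 / σ)]
    refine ((hasDerivAt_inv hξ.ne').const_mul (1 / σ)).congr_deriv ?_
    ring
  have hN : Complex.normSq (ξ ^ (1 / σ) • Q ξ) ^ σ = ξ ^ 2 * ‖Q ξ‖ ^ (2 * σ) := by
    rw [Complex.normSq_eq_norm_sq, norm_smul, Real.norm_of_nonneg (by positivity), mul_pow,
      Real.mul_rpow (by positivity) (by positivity)]
    congr 1
    · rw [← Real.rpow_natCast, ← Real.rpow_mul hξ.le, ← Real.rpow_mul hξ.le,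
        ← Real.rpow_natCast]
      congr 1
      field_simp
    · rw [← Real.rpow_natCast, ← Real.rpow_mul (norm_nonneg _)]
      norm_num
  have hξC : (ξ : ℂ) ≠ 0 := Complex.ofReal_ne_zero.2 hξ.ne'
  have hσC : (σ : ℂ) ≠ 0 := Complex.ofReal_ne_zero.2 hσ.ne'
  constructor
  · refine (hw.smul hQ).congr_deriv ?_
    rw [smul_add, smul_smul, mul_comm (1 / σ / ξ)]
  · refine (hw.smul (hP.add (hi.smul hQ))).congr_deriv ?_
    rw [hN, hS, hd]
    simp only [profileForcing, Complex.real_smul, Pi.add_apply, Pi.smul_apply']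
    push_cast
    generalize ((ξ ^ (1 / σ) : ℝ) : ℂ) = w
    generalize ((‖Q ξ‖ ^ (2 * σ) : ℝ) : ℂ) = n
    field_simp
    ring

theorem mainTheorem2 (d σ a : ℝ) (hsc : criticalIndex d σ = 1 / 2) (hσ : 1 / 2 < σ) (ha : 0 < a) :
    ∃ Q : ℝ → ℂ, IsGlobalProfile d σ a Q ∧ (∃ ξ : ℝ, 0 ≤ ξ ∧ Q ξ ≠ 0) ∧
      ∃ R : ℝ → ℂ, (∃ C : ℝ, ∀ ξ : ℝ, 0 < ξ → ‖R ξ‖ ≤ C) ∧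
        ∀ ξ : ℝ, 0 < ξ → Q ξ = (1 / ((ξ ^ (1 / σ) : ℝ) : ℂ)) * R ξ := by
  have hσ0 : 0 < σ := by linarith
  have hk : 0 < 1 / σ := by positivity
  have hd : d - 1 = 2 * (1 / σ) := by
    rw [criticalIndex] at hsc
    linarith
  obtain ⟨Q, P, S, hSc, hQ0, hP0, hQ, hP, hS⟩ :=
    exists_global_profileODE (d := d) (by linarith) hσ ha
  set R : ℝ → ℂ := fun ξ => ξ ^ (1 / σ) • Q ξ
  have hres := fun ξ (hξ : 0 < ξ) =>
    hasDerivAt_rescaled_profile hd hσ0 hξ (hQ ξ hξ.le) (hP ξ hξ.le) (hS ξ hξ)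
  obtain ⟨ξ₁, C₁, hC₁⟩ := exists_normSq_le_of_rescaled (R := R) hσ0 ha
    (fun ξ hξ => (hres ξ hξ).1) (fun ξ hξ => (hres ξ hξ).2) fun ξ _ => rfl
  -- On `[0, ξ₁]` compactness suffices: the exponent `1 / σ` is positive, so `R` is continuous up to
  -- `0`.
  obtain ⟨C₂, hC₂⟩ := (isCompact_Icc (a := (0 : ℝ)) (b := ξ₁)).exists_bound_of_continuousOn
    (f := R) fun ξ hξ => ((Real.continuous_rpow_const hk.le).continuousAt.smul
      (hQ ξ hξ.1).continuousAt).continuousWithinAt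
  have hbound : ∀ ξ, 0 < ξ → ‖R ξ‖ ≤ max (√C₁) C₂ := fun ξ hξ => by
    rcases le_total ξ₁ ξ with h | h
    · exact (Real.sqrt_le_sqrt (hC₁ ξ h)).trans (le_max_left _ _)
    · exact (hC₂ ξ ⟨hξ.le, h⟩).trans (le_max_right _ _)
  have hQR : ∀ ξ : ℝ, 0 < ξ → Q ξ = (1 / ((ξ ^ (1 / σ) : ℝ) : ℂ)) * R ξ := fun ξ hξ => by
    have : ((ξ ^ (1 / σ) : ℝ) : ℂ) ≠ 0 := Complex.ofReal_ne_zero.2 (by positivity)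
    simp only [R, Complex.real_smul]
    field_simp
  refine ⟨Q, ⟨contDiffOn_two_of_hasDerivAt hQ hP hSc, fun ξ hξ => ?_, ?_, by simp [hQ0], ?_⟩,
    ⟨0, le_rfl, by simp [hQ0]⟩, R, ⟨_, hbound⟩, hQR⟩
  · have hev : deriv Q =ᶠ[𝓝 ξ] P := by
      filter_upwards [lt_mem_nhds hξ] with s hs using (hQ s hs.le).deriv
    rw [radialLaplacian, hev.deriv_eq, (hP ξ hξ.le).deriv, hev.eq_of_nhds, hS ξ hξ,
      profileForcing, Complex.real_smul]
    ring
  · exact hP0 ▸ (hQ 0 le_rfl).hasDerivWithinAt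
  · have h0 : Tendsto (fun ξ : ℝ => ξ ^ (-(1 / σ)) * max (√C₁) C₂) atTop (𝓝 0) := by
      simpa using (tendsto_rpow_neg_atTop hk).mul_const (max (√C₁) C₂)
    refine squeeze_zero_norm' ?_ h0
    filter_upwards [eventually_gt_atTop 0] with ξ hξ
    rw [hQR ξ hξ, norm_mul, norm_div, norm_one, Complex.norm_of_nonneg (by positivity),
      Real.rpow_neg hξ.le, one_div (ξ ^ (1 / σ))]
    exact mul_le_mul_of_nonneg_left (hbound ξ hξ) (by positivity)
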